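/- Let $N,M\in\mathbb{Z}_{\ge 0}$, let $U$ be a compact metric space, $A:U\to GL(N,\mathbb{R})$ continuous, and $B\in\mathbb{R}^{N\times M}$. Consider the stochastic control system $$x_{t+1}=A(u_t)x_t+Bv_t+w_t,\qquad t=0,1,2,\ldots,\qquad (1)$$ with control variables $u_t\in U$, $v_t\in\mathbb{R}^M$, where $(w_t)_{t\ge 0}$ is an i.i.d. sequence of $\mathbb{R}^N$-valued random variables and the initial state $x_0$ is an $\mathbb{R}^N$-valued random variable, independent of $(w_t)_{t\ge0}$, whose law $\pi_0$ is absolutely continuous with respect to Lebesgue measure; all random variables live on one probability space $(\Omega,\mathcal{F},P)$. A causal coding and control policy over a noiseless channel with finite alphabet $\mathcal{M}$, of capacity $C=\log_2\#\mathcal{M}$, consists of encoder maps giving $q_t=\gamma^e_t(x_0,\ldots,x_t)\in\mathcal{M}$ and controller maps giving $(u_t,v_t)=\gamma^c_t(q_0,\ldots,q_t)\in U\times\mathbb{R}^M$, $t\ge 0$. The AMS property is achieved by such a policy if the resulting closed-loop state process $(x_t)_{t\ge0}$ of random variables is asymptotically mean stationary: there is a probability measure $\bar P$ on the Borel sets of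 $(\mathbb{R}^N)^{\mathbb{Z}_{\ge0}}$ with $$\lim_{T\to\infty}\frac1T\sum_{t=0}^{T-1}P\big((x_{t+s})_{s\ge0}\in F\big)=\bar P(F)\quad\text{for every Borel set }F\subset(\mathbb{R}^N)^{\mathbb{Z}_{\ge0}}.$$ For $\bar u=(u_s)_{s\in\mathbb{Z}}\in U^{\mathbb{Z}}$ and $t\in\mathbb{Z}$ let $(\theta^t\bar u)_s=u_{s+t}$ and let $\Phi(t,\bar u)$ be the cocycle of $x_{t+1}=A(u_t)x_t$, i.e. $\Phi(t,\bar u)=A(u_{t-1})\cdots A(u_0)$ for $t\ge1$, $\Phi(0,\bar u)=I$, and $\Phi(t,\bar u)=A(u_t)^{-1}\cdots A(u_{-1})^{-1}$ for $t<0$. Give $U^{\mathbb{Z}}$ the product topology and assume that there is a continuous invariant splitting $$U^{\mathbb{Z}}\times\mathbb{R}^N=\mathcal{V}^1\oplus\mathcal{V}^2,$$ that is, $\mathcal{V}^1,\mathcal{V}^2$ are continuous vector subbundles of the trivial bundle (the fibers are locally spanned by continuous frames) with $\mathcal{V}^1_{\bar u}\oplus\mathcal{V}^2_{\bar u}=\mathbb{R}^N$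 and $\Phi(t,\bar u)\mathcal{V}^i_{\bar u}=\mathcal{V}^i_{\theta^t\bar u}$ for $i=1,2$ and all $t\in\mathbb{Z}$, $\bar u\in U^{\mathbb{Z}}$. If the AMS property is achieved for (1) by a causal coding and control policy over a noiseless channel of capacity $C$, then $$C\ \ge\ \inf_{\bar u\in U^{\mathbb{Z}}}\ \limsup_{t\to\infty}\ \frac1t\log_2\left|\det\left(\Phi(t,\bar u)|_{\mathcal{V}^1_{\bar u}}:\mathcal{V}^1_{\bar u}\to\mathcal{V}^1_{\theta^t\bar u}\right)\right|,$$ where $|\det|$ is computed in orthonormal bases of the two fibers with respect to the standard inner product of $\mathbb{R}^N$. -/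

import Mathlib

open Filter Topology MeasureTheory ProbabilityTheory

namespace NetworkedControl

/-! ### Causal coding and control over a noiseless channel, and the closed loop -/

/-- A causal coding and control policy over a noiseless channel with alphabet `M`: at time `t` the
encoder maps the states `x_0, …, x_t` to a symbol `q_t`, and the controller maps the symbols
`q_0, …, q_t` to a control value. -/
structure CausalPolicy (X M C : Type*) where
  encode : (t : ℕ) → (Fin (t + 1) → X) → M
  control : (t : ℕ) → (Fin (t + 1) → M) → C

/-- Capacity (base-2 logarithm of the size of the alphabet) of the noiseless channel. -/
noncomputable def channelCapacity (M : Type*) [Fintype M] : ℝ :=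
  Real.logb 2 (Fintype.card M)

/-- The state trajectory of `x_{t+1} = f (x_t, c_t, w_t)` in closed loop with the policy `γ`, for
the initial state `x₀` and the noise realization `w`. -/
def closedLoop {X M C W : Type*} (f : X → C → W → X) (γ : CausalPolicy X M C) (x₀ : X)
    (w : ℕ → W) : ℕ → X
  | 0 => x₀
  | t + 1 =>
      f (closedLoop f γ x₀ w t)
        (γ.control t fun i : Fin (t + 1) =>
          γ.encode i fun j : Fin (i + 1) => closedLoop f γ x₀ w j)
        (w t)
  termination_by t => t
  decreasing_by
    · omega
    · have := i.2
      have := j.2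
      omega

theorem closedLoop_zero {X M C W : Type*} (f : X → C → W → X) (γ : CausalPolicy X M C) (x₀ : X)
    (w : ℕ → W) : closedLoop f γ x₀ w 0 = x₀ := by
  rw [closedLoop]

theorem closedLoop_succ {X M C W : Type*} (f : X → C → W → X) (γ : CausalPolicy X M C) (x₀ : X)
    (w : ℕ → W) (t : ℕ) :
    closedLoop f γ x₀ w (t + 1) =
      f (closedLoop f γ x₀ w t)
        (γ.control t fun i : Fin (t + 1) =>
          γ.encode i fun j : Fin (i + 1) => closedLoop f γ x₀ w j)
        (w t) := by
  rw [closedLoop]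

/-! ### Asymptotic mean stationarity -/

/-- Left shift on one-sided sequences. -/
def leftShift {X : Type*} (x : ℕ → X) : ℕ → X := fun t => x (t + 1)

/-- The law of the process `x` on sequence space. -/
noncomputable def processLaw {Ω X : Type*} [MeasurableSpace Ω] [MeasurableSpace X]
    (P : Measure Ω) (x : ℕ → Ω → X) : Measure (ℕ → X) :=
  P.map fun ω t => x t ω

/-- Asymptotic mean stationarity of a process of random variables: the Cesàro averages of the
shifted process laws converge, on every measurable set, to a probability measure. -/
def IsAMS {Ω X : Type*} [MeasurableSpace Ω] [MeasurableSpace X]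
    (P : Measure Ω) (x : ℕ → Ω → X) : Prop :=
  ∃ Pbar : Measure (ℕ → X), IsProbabilityMeasure Pbar ∧
    ∀ F : Set (ℕ → X), MeasurableSet F →
      Tendsto (fun T : ℕ =>
          (1 / (T : ℝ)) * ∑ t ∈ Finset.range T, (processLaw P x).real (leftShift^[t] ⁻¹' F))
        atTop (𝓝 (Pbar.real F))

/-! ### Semilinear systems and the homogeneous cocycle -/

/-- Right-hand side `A(u) x + B v + w` of the inhomogeneous semilinear system; a control value is
a pair `(u, v)`. -/
noncomputable def semilinear {N m : ℕ} {U : Type*} (A : U → Matrix.GeneralLinearGroup (Fin N) ℝ)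
    (B : Matrix (Fin N) (Fin m) ℝ) (x : EuclideanSpace ℝ (Fin N))
    (c : U × EuclideanSpace ℝ (Fin m)) (w : EuclideanSpace ℝ (Fin N)) :
    EuclideanSpace ℝ (Fin N) :=
  Matrix.toEuclideanLin (A c.1 : Matrix (Fin N) (Fin N) ℝ) x + Matrix.toEuclideanLin B c.2 + w

/-- `A(u_{n-1}) ⋯ A(u_0)`. -/
def forwardProduct {G U : Type*} [Group G] (A : U → G) (u : ℤ → U) : ℕ → G
  | 0 => 1
  | n + 1 => A (u (n : ℤ)) * forwardProduct A u n

/-- `A(u_{-n})⁻¹ ⋯ A(u_{-1})⁻¹`. -/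
def backwardProduct {G U : Type*} [Group G] (A : U → G) (u : ℤ → U) : ℕ → G
  | 0 => 1
  | n + 1 => (A (u (-((n : ℤ) + 1))))⁻¹ * backwardProduct A u n

/-- The cocycle of the homogeneous system `x_{t+1} = A(u_t) x_t`, in two-sided time. -/
def cocycle {G U : Type*} [Group G] (A : U → G) : ℤ → (ℤ → U) → G
  | Int.ofNat n, u => forwardProduct A u n
  | Int.negSucc n, u => backwardProduct A u (n + 1)

/-- The cocycle as a linear map `Φ(t, u)` of `ℝᴺ`. -/
noncomputable def Phi {N : ℕ} {U : Type*} (A : U → Matrix.GeneralLinearGroup (Fin N) ℝ) (t : ℤ)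
    (u : ℤ → U) : EuclideanSpace ℝ (Fin N) →ₗ[ℝ] EuclideanSpace ℝ (Fin N) :=
  Matrix.toEuclideanLin
    ((cocycle A t u : Matrix.GeneralLinearGroup (Fin N) ℝ) : Matrix (Fin N) (Fin N) ℝ)

/-- The `t`-th power of the shift on two-sided sequences. -/
def shift {U : Type*} (t : ℤ) (u : ℤ → U) : ℤ → U := fun s => u (s + t)

/-! ### Invariant subbundles -/

/-- A continuous subbundle of the trivial bundle `X × E`, given by its fibers: near every base
point the fibers are spanned by a frame of continuous sections. -/
def IsContinuousSubbundle {X E : Type*} [TopologicalSpace X] [NormedAddCommGroup E]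
    [NormedSpace ℝ E] (V : X → Submodule ℝ E) : Prop :=
  ∀ x₀ : X, ∃ O ∈ 𝓝 x₀, ∃ (k : ℕ) (s : Fin k → X → E),
    (∀ i, ContinuousOn (s i) O) ∧
    ∀ x ∈ O, LinearIndependent ℝ (fun i => s i x) ∧
      Submodule.span ℝ (Set.range fun i => s i x) = V x

/-- Invariance of a family of fibers under the homogeneous system. -/
def IsInvariant {N : ℕ} {U : Type*} (A : U → Matrix.GeneralLinearGroup (Fin N) ℝ)
    (V : (ℤ → U) → Submodule ℝ (EuclideanSpace ℝ (Fin N))) : Prop :=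
  ∀ (t : ℤ) (u : ℤ → U), (V u).map (Phi A t u) = V (shift t u)

/-- The restriction `Φ(t, u)|_{V_u} : V_u → V_{θᵗ u}` for an invariant family of fibers. -/
noncomputable def fiberMap {N : ℕ} {U : Type*} {A : U → Matrix.GeneralLinearGroup (Fin N) ℝ}
    {V : (ℤ → U) → Submodule ℝ (EuclideanSpace ℝ (Fin N))} (hV : IsInvariant A V) (t : ℤ)
    (u : ℤ → U) : V u →ₗ[ℝ] V (shift t u) :=
  (Phi A t u).restrict fun _ hx => hV t u ▸ Submodule.mem_map_of_mem hx

/-- Absolute value of the determinant of a linear map between Euclidean spaces of equal dimension,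
computed in orthonormal bases (by `absDet_eq`, any orthonormal bases give the same value). -/
noncomputable def absDet {E F : Type*} [NormedAddCommGroup E] [InnerProductSpace ℝ E]
    [FiniteDimensional ℝ E] [NormedAddCommGroup F] [InnerProductSpace ℝ F]
    [FiniteDimensional ℝ F] (L : E →ₗ[ℝ] F) : ℝ :=
  open Classical in
  if h : Module.finrank ℝ F = Module.finrank ℝ E then
    |(LinearMap.toMatrix (stdOrthonormalBasis ℝ E).toBasis
      ((stdOrthonormalBasis ℝ F).reindex (finCongr h)).toBasis L).det|
  else 0

theorem absDet_eq {E F ι : Type*} [NormedAddCommGroup E] [InnerProductSpace ℝ E]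
    [FiniteDimensional ℝ E] [NormedAddCommGroup F] [InnerProductSpace ℝ F]
    [FiniteDimensional ℝ F] [Fintype ι] [DecidableEq ι] (L : E →ₗ[ℝ] F)
    (e : OrthonormalBasis ι ℝ E) (f : OrthonormalBasis ι ℝ F) :
    absDet L = |(LinearMap.toMatrix e.toBasis f.toBasis L).det| := by
  have hE : Module.finrank ℝ E = Fintype.card ι := Module.finrank_eq_card_basis e.toBasis
  have hF : Module.finrank ℝ F = Fintype.card ι := Module.finrank_eq_card_basis f.toBasis
  have h : Module.finrank ℝ F = Module.finrank ℝ E := hF.trans hE.symm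
  have σ : ι ≃ Fin (Module.finrank ℝ E) := Fintype.equivFinOfCardEq hE.symm
  rw [absDet, dif_pos h]
  set e' := stdOrthonormalBasis ℝ E
  set f' := (stdOrthonormalBasis ℝ F).reindex (finCongr h)
  have key : LinearMap.toMatrix e'.toBasis f'.toBasis L
      = f'.toBasis.toMatrix (f.reindex σ).toBasis
        * LinearMap.toMatrix (e.reindex σ).toBasis (f.reindex σ).toBasis L
        * (e.reindex σ).toBasis.toMatrix e'.toBasis := by
    rw [basis_toMatrix_mul_linearMap_toMatrix_mul_basis_toMatrix]
  have hre : LinearMap.toMatrix (e.reindex σ).toBasis (f.reindex σ).toBasis L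
      = Matrix.reindex σ σ (LinearMap.toMatrix e.toBasis f.toBasis L) := by
    ext i j
    simp [LinearMap.toMatrix_apply]
  have h1 : |(f'.toBasis.toMatrix (f.reindex σ).toBasis).det| = 1 := by
    have := f'.det_to_matrix_orthonormalBasis_real (f.reindex σ)
    rw [Module.Basis.det_apply] at this
    rcases this with h | h <;> simp_all
  have h2 : |((e.reindex σ).toBasis.toMatrix e'.toBasis).det| = 1 := by
    have := (e.reindex σ).det_to_matrix_orthonormalBasis_real e'
    rw [Module.Basis.det_apply] at this
    rcases this with h | h <;> simp_all
  rw [key, Matrix.det_mul, Matrix.det_mul, abs_mul, abs_mul, h1, h2, hre, Matrix.det_reindex_self]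
  simp

end NetworkedControl

/-!
Suppose that the capacity `C` is smaller than the infimum, and choose a real `c` strictly between
the two. The proof shows that the state then leaves every ball, `P (‖x_T‖ ≤ R) → 0` for every `R`,
which no asymptotically mean stationary process does
(`not_isAMS_of_tendsto_measure_bounded_zero`): the stationary mean would give full mass to
`{‖x_0‖ > n}` for every `n`.

*Uniform growth.* Write `d(t, u) = |det Φ(t, u)|_{V₁}|`. By assumption every `u` has some time
`t ≥ 1` with `log₂ d(t, u) > c t`. Since `log₂ d` is an additive cocycle, continuous in `u`, over the
compact space `U^ℤ`, finitely many such times suffice for all `u`, and concatenating them yields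
`d(t, u) ≥ a 2 ^ (c t)` with one constant `a > 0` (`bddBelow_of_forall_exists_pos`,
`exists_le_absDet_fiberMap`). Multiplicativity and continuity of `d` come from the Gram determinant
identity `det_gram_comp`.

*Volume.* For a fixed word of channel symbols and a fixed noise realization, `x_T` is an affine
function `Φ(T, u) x_0 + const` of the initial state. Replacing the action of `Φ(T, u)` on the
complement of `V₁` by an isometry produces a map of determinant `d(T, u)` which sends
`{‖x_0‖ ≤ R, ‖x_T‖ ≤ R}` into a ball whose radius depends only on `R` and on a bound for the
projections along the splitting (`absDet_mul_volume_le`, `exists_projection_bound`). That set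
therefore has volume `O(1 / d(T, u))`.

*Counting.* Up to time `T` there are only `#M ^ T = 2 ^ (C T)` words, so for every noise realization
the initial states in question lie in a set of volume `O(2 ^ ((C - c) T))`, which tends to zero. As
the law of `x_0` is absolutely continuous and independent of the noise, Fubini's theorem gives
`P (‖x_0‖ ≤ R, ‖x_T‖ ≤ R) → 0` (`tendsto_measure_bounded_zero`), and finally the condition on `x_0`
is removed because its law is carried by large balls up to small mass.
-/

namespace NetworkedControl

/-! ### Absolute determinants and Gram determinants -/

/-- A linear map multiplies Gram determinants of full families by the square of its absolute
determinant. -/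
theorem det_gram_comp {E F ι : Type*} [NormedAddCommGroup E] [InnerProductSpace ℝ E]
    [FiniteDimensional ℝ E] [NormedAddCommGroup F] [InnerProductSpace ℝ F]
    [FiniteDimensional ℝ F] [Fintype ι] [DecidableEq ι] (L : E →ₗ[ℝ] F)
    (hE : Module.finrank ℝ E = Fintype.card ι) (hF : Module.finrank ℝ F = Fintype.card ι)
    (v : ι → E) :
    (Matrix.gram ℝ fun i => L (v i)).det = absDet L ^ 2 * (Matrix.gram ℝ v).det := by
  let e : OrthonormalBasis ι ℝ E :=
    (stdOrthonormalBasis ℝ E).reindex (Fintype.equivFinOfCardEq hE.symm).symm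
  let f : OrthonormalBasis ι ℝ F :=
    (stdOrthonormalBasis ℝ F).reindex (Fintype.equivFinOfCardEq hF.symm).symm
  have hmul : (Matrix.of fun i j => f.repr (L (v j)) i)
      = LinearMap.toMatrix e.toBasis f.toBasis L * Matrix.of fun i j => e.repr (v j) i := by
    ext i j
    have := congrFun (LinearMap.toMatrix_mulVec_repr e.toBasis f.toBasis L (v j)) i
    simpa [Matrix.mulVec, dotProduct, Matrix.mul_apply] using this.symm
  rw [Matrix.gram_eq_conjTranspose_mul f, Matrix.gram_eq_conjTranspose_mul e, hmul,
    absDet_eq L e f, sq_abs]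
  simp only [Matrix.conjTranspose_eq_transpose_of_trivial, Matrix.det_mul, Matrix.det_transpose]
  ring

theorem absDet_self {E : Type*} [NormedAddCommGroup E] [InnerProductSpace ℝ E]
    [FiniteDimensional ℝ E] (L : E →ₗ[ℝ] E) : absDet L = |LinearMap.det L| := by
  rw [absDet_eq L (stdOrthonormalBasis ℝ E) (stdOrthonormalBasis ℝ E), LinearMap.det_toMatrix]

theorem absDet_pos {E F : Type*} [NormedAddCommGroup E] [InnerProductSpace ℝ E]
    [FiniteDimensional ℝ E] [NormedAddCommGroup F] [InnerProductSpace ℝ F]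
    [FiniteDimensional ℝ F] (L : E →ₗ[ℝ] F) (h : Module.finrank ℝ F = Module.finrank ℝ E)
    (hL : Function.Injective L) : 0 < absDet L := by
  let e := stdOrthonormalBasis ℝ E
  have hnn : 0 ≤ absDet L := by
    rw [absDet_eq L e ((stdOrthonormalBasis ℝ F).reindex (finCongr h))]
    exact abs_nonneg _
  refine lt_of_le_of_ne hnn fun h0 => ?_
  have := det_gram_comp L (by simp) (by simp [h]) e
  rw [← h0, zero_pow two_ne_zero, zero_mul] at this
  exact Matrix.det_gram_ne_zero_iff_linearIndependent.2
    (e.toBasis.linearIndependent.map' L (LinearMap.ker_eq_bot.2 hL))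
    (by simpa [Function.comp_def] using this)

/-! ### Volume contraction for a map preserving a splitting -/

/-- The orthonormal basis of the ambient space obtained by joining orthonormal bases of a subspace
and of its orthogonal complement. -/
noncomputable def adaptedBasis {E ι κ : Type*} [NormedAddCommGroup E] [InnerProductSpace ℝ E]
    [FiniteDimensional ℝ E] [Fintype ι] [Fintype κ] (V : Submodule ℝ E)
    (e : OrthonormalBasis ι ℝ V) (f : OrthonormalBasis κ ℝ Vᗮ) : OrthonormalBasis (ι ⊕ κ) ℝ E :=
  (e.prod f).map V.orthogonalDecomposition.symm

theorem adaptedBasis_inl {E ι κ : Type*} [NormedAddCommGroup E] [InnerProductSpace ℝ E]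
    [FiniteDimensional ℝ E] [Fintype ι] [Fintype κ] (V : Submodule ℝ E)
    (e : OrthonormalBasis ι ℝ V) (f : OrthonormalBasis κ ℝ Vᗮ) (i : ι) :
    adaptedBasis V e f (Sum.inl i) = e i := by
  rw [adaptedBasis, OrthonormalBasis.map_apply, Submodule.orthogonalDecomposition_symm_apply]
  simp

theorem adaptedBasis_inr {E ι κ : Type*} [NormedAddCommGroup E] [InnerProductSpace ℝ E]
    [FiniteDimensional ℝ E] [Fintype ι] [Fintype κ] (V : Submodule ℝ E)
    (e : OrthonormalBasis ι ℝ V) (f : OrthonormalBasis κ ℝ Vᗮ) (i : κ) :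
    adaptedBasis V e f (Sum.inr i) = f i := by
  rw [adaptedBasis, OrthonormalBasis.map_apply, Submodule.orthogonalDecomposition_symm_apply]
  simp

/-- A map which carries `V` into `V'` by `L` and which is an isometry of `Vᗮ` onto `V'ᗮ` modulo
`V'` is block triangular in adapted orthonormal bases, so its determinant is that of `L`. -/
theorem absDet_eq_of_blockTriangular {E : Type*} [NormedAddCommGroup E] [InnerProductSpace ℝ E]
    [FiniteDimensional ℝ E] {V V' : Submodule ℝ E} (L : V →ₗ[ℝ] V')
    (hdim : Module.finrank ℝ V' = Module.finrank ℝ V) (J : Vᗮ ≃ₗᵢ[ℝ] V'ᗮ) (Ψ : E →ₗ[ℝ] E)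
    (hL : ∀ x : V, Ψ x = L x) (hJ : ∀ y : Vᗮ, Ψ y - J y ∈ V') : absDet Ψ = absDet L := by
  classical
  let e := stdOrthonormalBasis ℝ V
  let e' := (stdOrthonormalBasis ℝ V').reindex (finCongr hdim)
  let f := stdOrthonormalBasis ℝ Vᗮ
  let f' := f.map J
  have hmat : LinearMap.toMatrix (adaptedBasis V e f).toBasis (adaptedBasis V' e' f').toBasis Ψ
      = Matrix.fromBlocks (LinearMap.toMatrix e.toBasis e'.toBasis L)
          (Matrix.of fun i j => inner ℝ (e' i : E) (Ψ (f j))) 0 1 := by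
    ext (i | i) (j | j)
    · simp [LinearMap.toMatrix_apply, OrthonormalBasis.repr_apply_apply, adaptedBasis_inl, hL]
    · simp [LinearMap.toMatrix_apply, OrthonormalBasis.repr_apply_apply, adaptedBasis_inl,
        adaptedBasis_inr]
    · simp only [LinearMap.toMatrix_apply, OrthonormalBasis.coe_toBasis, adaptedBasis_inl, hL,
        OrthonormalBasis.coe_toBasis_repr_apply, OrthonormalBasis.repr_apply_apply,
        adaptedBasis_inr, Matrix.fromBlocks_apply₂₁, Matrix.zero_apply]
      exact Submodule.inner_left_of_mem_orthogonal (L (e j)).2 (f' i).2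
    · simp only [LinearMap.toMatrix_apply, OrthonormalBasis.coe_toBasis,
        OrthonormalBasis.coe_toBasis_repr_apply, OrthonormalBasis.repr_apply_apply,
        adaptedBasis_inr, Matrix.fromBlocks_apply₂₂]
      have h1 : inner ℝ (f' i : E) (Ψ (f j) - J (f j)) = 0 :=
        Submodule.inner_left_of_mem_orthogonal (hJ _) (f' i).2
      rw [inner_sub_right, sub_eq_zero] at h1
      rw [h1, ← Submodule.coe_inner]
      have := orthonormal_iff_ite.1 f'.orthonormal i j
      simpa [f', Matrix.one_apply] using this
  rw [absDet_eq Ψ (adaptedBasis V e f) (adaptedBasis V' e' f'), hmat,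
    Matrix.det_fromBlocks_zero₂₁, Matrix.det_one, mul_one, absDet_eq L e e']

/-- Volume estimate behind the lower bound: the vectors of norm at most `R` which an affine map
`Φ + c` sends back into the ball of radius `R` occupy a volume at most of order
`1 / |det (Φ|_V)|`, for every `Φ`-equivariant splitting. Only the norm of the projection onto
the image fiber enters the constant. -/
theorem absDet_mul_volume_le {E : Type*} [NormedAddCommGroup E] [InnerProductSpace ℝ E]
    [FiniteDimensional ℝ E] [MeasurableSpace E] [BorelSpace E] {V W V' W' : Submodule ℝ E}
    (h : IsCompl V W) (h' : IsCompl V' W') (hdim : Module.finrank ℝ V' = Module.finrank ℝ V)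
    (Φ : E →ₗ[ℝ] E) (L : V →ₗ[ℝ] V') (hL : ∀ x : V, Φ x = L x) (hW : ∀ x ∈ W, Φ x ∈ W')
    {κ : ℝ} (hκ0 : 0 ≤ κ) (hκ : ∀ x, ‖V'.projection W' h' x‖ ≤ κ * ‖x‖) (c : E) (R : ℝ) :
    ENNReal.ofReal (absDet L) * volume {x : E | ‖x‖ ≤ R ∧ ‖Φ x + c‖ ≤ R}
      ≤ volume (Metric.closedBall (0 : E) (κ * R + R)) := by
  have hperp : Module.finrank ℝ V'ᗮ = Module.finrank ℝ Vᗮ := by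
    have h1 := V.finrank_add_finrank_orthogonal
    have h2 := V'.finrank_add_finrank_orthogonal
    omega
  let J : Vᗮ ≃ₗᵢ[ℝ] V'ᗮ := (stdOrthonormalBasis ℝ Vᗮ).equiv
    ((stdOrthonormalBasis ℝ V'ᗮ).reindex (finCongr hperp)) (Equiv.refl _)
  -- `J` replaces the action of `Φ` transverse to `V`, whose determinant is not controlled.
  let Ψ : E →ₗ[ℝ] E := Φ ∘ₗ V.projection W h +
    V'ᗮ.subtype ∘ₗ J.toLinearEquiv.toLinearMap ∘ₗ (Vᗮ.orthogonalProjectionOnto : E →ₗ[ℝ] Vᗮ)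
  have hΨ (x : E) : Ψ x = Φ (V.projection W h x) + J (Vᗮ.orthogonalProjectionOnto x) := rfl
  have hdet : absDet Ψ = absDet L := by
    refine absDet_eq_of_blockTriangular L hdim J Ψ (fun x => ?_) fun y => ?_
    · rw [hΨ, Submodule.projection_apply_left, hL,
        Submodule.orthogonalProjectionOnto_orthogonal_apply_eq_zero x.2]
      simp
    · rw [hΨ, Submodule.orthogonalProjectionOnto_mem_subspace_eq_self, add_sub_cancel_right]
      have := hL ⟨_, V.projection_apply_mem h y⟩
      rw [this]
      exact Subtype.mem _
  have hcomm (x : E) : Φ (V.projection W h x) = V'.projection W' h' (Φ x) := by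
    have h1 : Φ x = Φ (V.projection W h x) + Φ (x - V.projection W h x) := by
      rw [← map_add, add_sub_cancel]
    have h2 : Φ (V.projection W h x) ∈ V' := by
      rw [hL ⟨_, V.projection_apply_mem h x⟩]; exact Subtype.mem _
    rw [h1, map_add, Submodule.projection_apply_of_mem_left h' h2,
      (Submodule.projection_apply_eq_zero_iff h').2 (hW _ (Submodule.sub_projection_mem h x)),
      add_zero]
  rw [← hdet, absDet_self, ← Measure.addHaar_image_linearMap]
  calc volume (Ψ '' {x : E | ‖x‖ ≤ R ∧ ‖Φ x + c‖ ≤ R})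
      ≤ volume (Metric.closedBall (-V'.projection W' h' c) (κ * R + R)) := by
        refine measure_mono ?_
        rintro _ ⟨x, ⟨hx, hx'⟩, rfl⟩
        rw [mem_closedBall_iff_norm, hΨ, hcomm, sub_neg_eq_add, add_right_comm, ← map_add]
        refine (norm_add_le _ _).trans (add_le_add ?_ ?_)
        · exact (hκ _).trans (mul_le_mul_of_nonneg_left hx' hκ0)
        · rw [← Submodule.coe_norm, LinearIsometryEquiv.norm_map]
          exact (Vᗮ.norm_orthogonalProjectionOnto_apply_le x).trans hx
    _ = _ := Measure.addHaar_closedBall_center _ _ _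

/-! ### Additive cocycles over a compact base -/

/-- A continuous additive cocycle over a compact base which becomes positive along every orbit is
bounded below: the positive times can be chosen from a finite set, and every time interval is a
concatenation of such times up to a remainder of bounded length. -/
theorem bddBelow_of_forall_exists_pos {X : Type*} [TopologicalSpace X] [CompactSpace X]
    (θ : ℕ → X → X) (g : ℕ → X → ℝ) (hg : ∀ t, Continuous (g t))
    (hadd : ∀ s t x, g (t + s) x = g t x + g s (θ t x)) (hpos : ∀ x, ∃ t, 0 < t ∧ 0 < g t x) :
    ∃ K, ∀ t x, K ≤ g t x := by
  choose τ hτ hτg using hpos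
  obtain ⟨F, hF⟩ := CompactSpace.elim_nhds_subcover (fun x => {y | 0 < g (τ x) y})
    fun x => (isOpen_lt continuous_const (hg (τ x))).mem_nhds (hτg x)
  let T := F.sup τ
  have hT (y : X) : ∃ t, 0 < t ∧ t ≤ T ∧ 0 < g t y := by
    have hy : y ∈ ⋃ x ∈ F, {y | 0 < g (τ x) y} := hF ▸ Set.mem_univ y
    simp only [Set.mem_iUnion, Set.mem_ofPred_eq, exists_prop] at hy
    obtain ⟨x, hx, hxy⟩ := hy
    exact ⟨τ x, hτ x, Finset.le_sup hx, hxy⟩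
  have hK (t : ℕ) : ∃ K, ∀ x, K ≤ g t x := by
    obtain ⟨K, hK⟩ := (isCompact_range (hg t)).bddBelow
    exact ⟨K, fun x => hK ⟨x, rfl⟩⟩
  choose k hk using hK
  obtain ⟨K, hK⟩ := ((Finset.range (T + 1)).image k).bddBelow
  refine ⟨K, fun t => ?_⟩
  induction t using Nat.strong_induction_on with
  | _ t ih =>
    intro x
    rcases le_or_gt t T with h | h
    · exact (hK (Finset.mem_coe.2 (Finset.mem_image_of_mem k
        (Finset.mem_range.2 (Nat.lt_succ_of_le h))))).trans (hk t x)
    · obtain ⟨s, hs0, hsT, hs⟩ := hT x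
      have h1 := ih (t - s) (by omega) (θ s x)
      have h2 := hadd (t - s) s x
      rw [Nat.add_sub_cancel' (by omega)] at h2
      linarith

/-! ### The restricted cocycle -/

section Bundle
variable {N : ℕ} {U : Type*} {A : U → Matrix.GeneralLinearGroup (Fin N) ℝ}
  {V W : (ℤ → U) → Submodule ℝ (EuclideanSpace ℝ (Fin N))}

theorem Phi_apply (t : ℕ) (u : ℤ → U) (y : EuclideanSpace ℝ (Fin N)) :
    Phi A t u y = WithLp.toLp 2
      (((forwardProduct A u t).val : Matrix (Fin N) (Fin N) ℝ).mulVec y.ofLp) :=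
  rfl

theorem Phi_zero (u : ℤ → U) (y : EuclideanSpace ℝ (Fin N)) : Phi A (0 : ℕ) u y = y := by
  rw [Phi_apply]
  simp [forwardProduct]

theorem Phi_succ (t : ℕ) (u : ℤ → U) (y : EuclideanSpace ℝ (Fin N)) :
    Phi A (t + 1 : ℕ) u y
      = Matrix.toEuclideanLin ((A (u t)).val : Matrix (Fin N) (Fin N) ℝ) (Phi A t u y) := by
  rw [Phi_apply, Phi_apply]
  simp [forwardProduct, Matrix.toEuclideanLin, Matrix.toLpLin_apply, Matrix.mulVec_mulVec]

theorem forwardProduct_add {G : Type*} [Group G] (A : U → G) (s t : ℕ) (u : ℤ → U) :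
    forwardProduct A u (t + s) = forwardProduct A (shift t u) s * forwardProduct A u t := by
  induction s with
  | zero => simp [forwardProduct]
  | succ s ih =>
    rw [← add_assoc, forwardProduct, ih, forwardProduct, mul_assoc]
    simp [shift, add_comm]

theorem Phi_add (s t : ℕ) (u : ℤ → U) (y : EuclideanSpace ℝ (Fin N)) :
    Phi A (t + s : ℕ) u y = Phi A s (shift t u) (Phi A t u y) := by
  rw [Phi_apply, Phi_apply, Phi_apply]
  simp [forwardProduct_add, Matrix.mulVec_mulVec]

theorem Phi_injective (t : ℕ) (u : ℤ → U) : Function.Injective (Phi A t u) := by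
  intro a b hab
  exact WithLp.ofLp_injective 2 (Matrix.mulVec_injective_of_isUnit (forwardProduct A u t).isUnit
    (WithLp.toLp_injective 2 hab))

theorem continuous_Phi [TopologicalSpace U] (hA : Continuous A) (t : ℕ) :
    Continuous fun p : (ℤ → U) × EuclideanSpace ℝ (Fin N) => Phi A t p.1 p.2 := by
  have hF : Continuous fun u : ℤ → U => forwardProduct A u t := by
    induction t with
    | zero => exact continuous_const
    | succ t ih => exact (hA.comp (continuous_apply _)).mul ih
  have h1 : Continuous fun p : (ℤ → U) × EuclideanSpace ℝ (Fin N) =>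
      ((forwardProduct A p.1 t).val : Matrix (Fin N) (Fin N) ℝ).mulVec p.2.ofLp :=
    ((Units.continuous_val.comp hF).comp continuous_fst).matrix_mulVec
      ((PiLp.continuous_ofLp 2 _).comp continuous_snd)
  exact (PiLp.continuous_toLp 2 _).comp h1

theorem finrank_shift (hV : IsInvariant A V) (t : ℕ) (u : ℤ → U) :
    Module.finrank ℝ (V (shift t u)) = Module.finrank ℝ (V u) := by
  rw [← hV t u]
  exact (LinearEquiv.finrank_eq ((V u).equivMapOfInjective _ (Phi_injective t u))).symm

theorem absDet_fiberMap_pos (hV : IsInvariant A V) (t : ℕ) (u : ℤ → U) :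
    0 < absDet (fiberMap hV t u) :=
  absDet_pos _ (finrank_shift hV t u) fun _ _ h =>
    Subtype.ext (Phi_injective t u (congrArg Subtype.val h))

/-- The determinant of the restricted cocycle read off from Gram determinants in the ambient
space, where no basis of the image fiber is needed. -/
theorem det_gram_Phi (hV : IsInvariant A V) (t : ℕ) (u : ℤ → U) {k : ℕ}
    (hk : Module.finrank ℝ (V u) = k) (v : Fin k → EuclideanSpace ℝ (Fin N))
    (hv : ∀ i, v i ∈ V u) :
    (Matrix.gram ℝ fun i => Phi A t u (v i)).det
      = absDet (fiberMap hV t u) ^ 2 * (Matrix.gram ℝ v).det :=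
  det_gram_comp (fiberMap hV t u) (by simp [hk]) (by simp [finrank_shift hV, hk])
    fun i => (⟨v i, hv i⟩ : V u)

theorem absDet_fiberMap_add (hV : IsInvariant A V) (s t : ℕ) (u : ℤ → U) :
    absDet (fiberMap hV (t + s : ℕ) u)
      = absDet (fiberMap hV t u) * absDet (fiberMap hV s (shift t u)) := by
  let b := Module.finBasis ℝ (V u)
  let v : Fin (Module.finrank ℝ (V u)) → EuclideanSpace ℝ (Fin N) := fun i => b i
  have hv0 : (Matrix.gram ℝ v).det ≠ 0 := Matrix.det_gram_ne_zero_iff_linearIndependent.2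
    (b.linearIndependent.map' (V u).subtype (V u).ker_subtype)
  have h1 := det_gram_Phi hV (t + s) u rfl v fun i => (b i).2
  have h2 := det_gram_Phi hV t u rfl v fun i => (b i).2
  have h3 := det_gram_Phi hV s (shift t u) (finrank_shift hV t u) (fun i => Phi A t u (v i))
    fun i => hV t u ▸ Submodule.mem_map_of_mem (b i).2
  simp only [← Phi_add] at h3
  rw [h1, h2, ← mul_assoc] at h3
  have h4 := mul_right_cancel₀ hv0 h3
  rw [← mul_pow] at h4
  rw [(sq_eq_sq₀ (absDet_fiberMap_pos hV _ u).le (mul_nonneg (absDet_fiberMap_pos hV _ _).le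
    (absDet_fiberMap_pos hV _ _).le)).1 h4, mul_comm]

theorem continuousAt_det_gram {X E ι : Type*} [TopologicalSpace X] [NormedAddCommGroup E]
    [InnerProductSpace ℝ E] [Fintype ι] [DecidableEq ι] {f : ι → X → E} {x₀ : X}
    (hf : ∀ i, ContinuousAt (f i) x₀) :
    ContinuousAt (fun x => (Matrix.gram ℝ fun i => f i x).det) x₀ := by
  have h : ContinuousAt (fun x => Matrix.gram ℝ fun i => f i x) x₀ :=
    continuousAt_pi.2 fun i => continuousAt_pi.2 fun j => (hf i).inner (hf j)
  exact (Continuous.matrix_det continuous_id).continuousAt.comp h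

theorem continuous_absDet_fiberMap [TopologicalSpace U] (hA : Continuous A)
    (hVc : IsContinuousSubbundle V) (hV : IsInvariant A V) (t : ℕ) :
    Continuous fun u => absDet (fiberMap hV t u) := by
  refine continuous_iff_continuousAt.2 fun u₀ => ?_
  obtain ⟨O, hO, k, s, hs, hsp⟩ := hVc u₀
  have hsc (i) : ContinuousAt (s i) u₀ := (hs i).continuousAt hO
  have hpos (u) (hu : u ∈ O) : (Matrix.gram ℝ fun i => s i u).det ≠ 0 :=
    Matrix.det_gram_ne_zero_iff_linearIndependent.2 (hsp u hu).1
  have heq (u) (hu : u ∈ O) : absDet (fiberMap hV t u) =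
      √((Matrix.gram ℝ fun i => Phi A t u (s i u)).det / (Matrix.gram ℝ fun i => s i u).det) := by
    have hk : Module.finrank ℝ (V u) = k := by
      rw [← (hsp u hu).2, finrank_span_eq_card (hsp u hu).1, Fintype.card_fin]
    have hmem (i) : s i u ∈ V u := (hsp u hu).2.le (Submodule.subset_span ⟨i, rfl⟩)
    rw [det_gram_Phi hV t u hk (fun i => s i u) hmem, mul_div_cancel_right₀ _ (hpos u hu),
      Real.sqrt_sq (absDet_fiberMap_pos hV t u).le]
  have hΦ (i) : ContinuousAt (fun u => Phi A t u (s i u)) u₀ :=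
    ContinuousAt.comp (g := fun p : (ℤ → U) × EuclideanSpace ℝ (Fin N) => Phi A t p.1 p.2)
      (f := fun u => (u, s i u)) (continuous_Phi hA t).continuousAt
      (continuousAt_id.prodMk (hsc i))
  have hdiv : ContinuousAt (fun u => (Matrix.gram ℝ fun i => Phi A t u (s i u)).det /
      (Matrix.gram ℝ fun i => s i u).det) u₀ :=
    (continuousAt_det_gram hΦ).div₀ (continuousAt_det_gram hsc) (hpos u₀ (mem_of_mem_nhds hO))
  refine ContinuousAt.congr hdiv.sqrt ?_
  filter_upwards [hO] with u hu using (heq u hu).symm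

/-- Uniform exponential growth of `|det Φ(t, u)|_V|` at all times from growth at a single positive
time depending on `u`. -/
theorem exists_le_absDet_fiberMap [TopologicalSpace U] [CompactSpace U] (hA : Continuous A)
    (hVc : IsContinuousSubbundle V) (hV : IsInvariant A V) {c : ℝ}
    (hc : ∀ u, ∃ t : ℕ, 0 < t ∧ c < 1 / (t : ℝ) * Real.logb 2 (absDet (fiberMap hV t u))) :
    ∃ a > 0, ∀ (t : ℕ) (u : ℤ → U), a * (2 : ℝ) ^ (c * t) ≤ absDet (fiberMap hV t u) := by
  obtain ⟨K, hK⟩ := bddBelow_of_forall_exists_pos (X := ℤ → U) (fun t => shift t)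
    (fun t u => Real.logb 2 (absDet (fiberMap hV t u)) - c * t)
    (fun t => by
      have := (continuous_absDet_fiberMap hA hVc hV t).log
        fun u => (absDet_fiberMap_pos hV t u).ne'
      exact (this.div_const _).sub continuous_const)
    (fun s t u => by
      rw [absDet_fiberMap_add, Real.logb_mul (absDet_fiberMap_pos hV _ _).ne'
        (absDet_fiberMap_pos hV _ _).ne']
      push_cast
      ring)
    (fun u => by
      obtain ⟨t, ht, h⟩ := hc u
      refine ⟨t, ht, ?_⟩
      rw [one_div, inv_mul_eq_div, lt_div_iff₀ (by exact_mod_cast ht)] at h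
      linarith)
  refine ⟨2 ^ K, by positivity, fun t u => ?_⟩
  rw [← Real.rpow_add two_pos, ← Real.le_logb_iff_rpow_le one_lt_two (absDet_fiberMap_pos hV t u)]
  linarith [hK t u]

end Bundle

/-! ### Uniform boundedness of the projections -/

/-- The projections of a continuous splitting over a compact base are uniformly bounded. In local
frames the projection is `G ∘ D ∘ G⁻¹`, where `G` sends coordinates to vectors and `D` forgets the
coordinates along the complement. -/
theorem exists_projection_bound {X E : Type*} [TopologicalSpace X] [CompactSpace X]
    [NormedAddCommGroup E] [NormedSpace ℝ E] [FiniteDimensional ℝ E]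
    {V W : X → Submodule ℝ E} (h : ∀ x, IsCompl (V x) (W x)) (hV : IsContinuousSubbundle V)
    (hW : IsContinuousSubbundle W) :
    ∃ κ : ℝ, 0 ≤ κ ∧ ∀ x y, ‖(V x).projection (W x) (h x) y‖ ≤ κ * ‖y‖ := by
  have : CompleteSpace E := FiniteDimensional.complete ℝ E
  have hloc (x₀ : X) : ∃ κ : ℝ, ∀ᶠ x in 𝓝 x₀,
      ∀ y, ‖(V x).projection (W x) (h x) y‖ ≤ κ * ‖y‖ := by
    obtain ⟨O, hO, k, s, hs, hsp⟩ := hV x₀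
    obtain ⟨O', hO', l, r, hr, hrp⟩ := hW x₀
    let G (x : X) : ((Fin k → ℝ) × (Fin l → ℝ)) →L[ℝ] E :=
      (∑ i, (ContinuousLinearMap.proj i).smulRight (s i x)) ∘L ContinuousLinearMap.fst ℝ _ _ +
        (∑ i, (ContinuousLinearMap.proj i).smulRight (r i x)) ∘L ContinuousLinearMap.snd ℝ _ _
    let D : ((Fin k → ℝ) × (Fin l → ℝ)) →L[ℝ] ((Fin k → ℝ) × (Fin l → ℝ)) :=
      (ContinuousLinearMap.fst ℝ _ _).prod 0
    have hG (x) (a : Fin k → ℝ) (b : Fin l → ℝ) :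
        G x (a, b) = ∑ i, a i • s i x + ∑ i, b i • r i x := by
      simp [G]
    have hGc : ContinuousAt G x₀ := by
      have hsum {n : ℕ} {f : Fin n → X → E} (hf : ∀ i, ContinuousAt (f i) x₀) : ContinuousAt
          (fun x => ∑ i, (ContinuousLinearMap.proj i : (Fin n → ℝ) →L[ℝ] ℝ).smulRight (f i x))
          x₀ := by
        refine tendsto_finsetSum _ fun i _ => ?_
        exact (ContinuousLinearMap.smulRightL ℝ (Fin n → ℝ) E
          (ContinuousLinearMap.proj i)).continuous.continuousAt.comp (hf i)
      exact ((hsum fun i => (hs i).continuousAt hO).clm_comp continuousAt_const).add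
        ((hsum fun i => (hr i).continuousAt hO').clm_comp continuousAt_const)
    have hVmem (x) (hx : x ∈ O) (a : Fin k → ℝ) : ∑ i, a i • s i x ∈ V x :=
      Submodule.sum_mem _ fun i _ =>
        Submodule.smul_mem _ _ ((hsp x hx).2 ▸ Submodule.subset_span ⟨i, rfl⟩)
    have hWmem (x) (hx : x ∈ O') (a : Fin l → ℝ) : ∑ i, a i • r i x ∈ W x :=
      Submodule.sum_mem _ fun i _ =>
        Submodule.smul_mem _ _ ((hrp x hx).2 ▸ Submodule.subset_span ⟨i, rfl⟩)
    have hbij (x) (hx : x ∈ O ∩ O') : Function.Bijective (G x) := by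
      constructor
      · refine (injective_iff_map_eq_zero (G x)).2 ?_
        rintro ⟨a, b⟩ hab
        rw [hG] at hab
        have h1 : ∑ i, a i • s i x ∈ W x := by
          rw [eq_neg_of_add_eq_zero_left hab]
          exact Submodule.neg_mem _ (hWmem x hx.2 b)
        have h2 := Submodule.disjoint_def.1 (h x).disjoint _ (hVmem x hx.1 a) h1
        rw [h2, zero_add] at hab
        have h3 := Fintype.linearIndependent_iff.1 (hsp x hx.1).1 a h2
        have h4 := Fintype.linearIndependent_iff.1 (hrp x hx.2).1 b hab
        ext i <;> simp [h3, h4]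
      · intro y
        have h1 := (V x).projection_apply_mem (h x) y
        have h2 := Submodule.sub_projection_mem (h x) y
        replace h1 := (hsp x hx.1).2.ge h1
        replace h2 := (hrp x hx.2).2.ge h2
        rw [Submodule.mem_span_range_iff_exists_fun] at h1 h2
        obtain ⟨a, ha⟩ := h1
        obtain ⟨b, hb⟩ := h2
        exact ⟨(a, b), by rw [hG, ha, hb, add_sub_cancel]⟩
    let e (x) (hx : x ∈ O ∩ O') : ((Fin k → ℝ) × (Fin l → ℝ)) ≃L[ℝ] E :=
      (LinearEquiv.ofBijective (G x).toLinearMap (hbij x hx)).toContinuousLinearEquiv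
    have he (x) (hx : x ∈ O ∩ O') : (e x hx : _ →L[ℝ] E) = G x := by
      ext : 1 <;> rfl
    have hmem₀ : x₀ ∈ O ∩ O' := ⟨mem_of_mem_nhds hO, mem_of_mem_nhds hO'⟩
    have hinv : ContinuousAt (fun x => ContinuousLinearMap.inverse (G x)) x₀ := by
      refine ContinuousAt.comp (g := ContinuousLinearMap.inverse) ?_ hGc
      rw [← he x₀ hmem₀]
      exact (contDiffAt_map_inverse (n := 0) (e x₀ hmem₀)).continuousAt
    have hQ : ContinuousAt (fun x => (G x ∘L D) ∘L ContinuousLinearMap.inverse (G x)) x₀ :=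
      (hGc.clm_comp continuousAt_const).clm_comp hinv
    refine ⟨‖(G x₀ ∘L D) ∘L ContinuousLinearMap.inverse (G x₀)‖ + 1, ?_⟩
    filter_upwards [hQ.norm.eventually (eventually_lt_nhds (lt_add_one _)), hO, hO']
      with x hx hxO hxO' y
    have hproj : (V x).projection (W x) (h x) y
        = ((G x ∘L D) ∘L ContinuousLinearMap.inverse (G x)) y := by
      obtain ⟨⟨a, b⟩, rfl⟩ := (hbij x ⟨hxO, hxO'⟩).2 y
      have h1 : ContinuousLinearMap.inverse (G x) (G x (a, b)) = (a, b) := by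
        rw [← he x ⟨hxO, hxO'⟩, ContinuousLinearMap.inverse_equiv]
        exact (e x ⟨hxO, hxO'⟩).symm_apply_apply _
      rw [ContinuousLinearMap.comp_apply, h1, ContinuousLinearMap.comp_apply, hG, map_add,
        Submodule.projection_apply_of_mem_left _ (hVmem x hxO a),
        (Submodule.projection_apply_eq_zero_iff _).2 (hWmem x hxO' b)]
      simp [D, hG]
    rw [hproj]
    exact (ContinuousLinearMap.le_opNorm _ _).trans
      (mul_le_mul_of_nonneg_right hx.le (norm_nonneg _))
  choose κ hκ using hloc
  obtain ⟨F, hF⟩ := CompactSpace.elim_nhds_subcover _ hκ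
  obtain ⟨K, hK⟩ := (F.image κ).bddAbove
  refine ⟨max K 0, le_max_right _ _, fun x y => ?_⟩
  have hx : x ∈ ⋃ x₀ ∈ F, {x | ∀ y, ‖(V x).projection (W x) (h x) y‖ ≤ κ x₀ * ‖y‖} :=
    hF ▸ Set.mem_univ x
  simp only [Set.mem_iUnion, Set.mem_ofPred_eq, exists_prop] at hx
  obtain ⟨x₀, hx₀, hx⟩ := hx
  exact (hx y).trans (mul_le_mul_of_nonneg_right
    ((hK (Finset.mem_coe.2 (Finset.mem_image_of_mem κ hx₀))).trans (le_max_left _ _))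
    (norm_nonneg _))

/-! ### Two measure-theoretic facts -/

/-- Absolute continuity of a finite measure in `ε`-`δ` form, for arbitrary sets. -/
theorem exists_pos_forall_measure_lt {α : Type*} [MeasurableSpace α] {μ ν : Measure α}
    [IsFiniteMeasure μ] [SigmaFinite ν] (h : μ ≪ ν) {ε : ENNReal} (hε : ε ≠ 0) :
    ∃ δ > 0, ∀ s, ν s < δ → μ s < ε := by
  obtain ⟨δ, hδ, H⟩ := exists_pos_setLIntegral_lt_of_measure_lt
    (Measure.lintegral_rnDeriv_lt_top μ ν).ne hε
  exact ⟨δ, hδ, fun s hs => by simpa [Measure.setLIntegral_rnDeriv h] using H s hs⟩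

theorem tendsto_measure_natCast_lt_norm {α E : Type*} [MeasurableSpace α] (μ : Measure α)
    [IsFiniteMeasure μ] [NormedAddCommGroup E] [MeasurableSpace E] [BorelSpace E] {f : α → E}
    (hf : Measurable f) : Tendsto (fun n : ℕ => μ {a | (n : ℝ) < ‖f a‖}) atTop (𝓝 0) := by
  have h := tendsto_measure_iInter_atTop (μ := μ) (s := fun n : ℕ => {a | (n : ℝ) < ‖f a‖})
    (fun n => (measurableSet_lt measurable_const hf.norm).nullMeasurableSet)
    (fun i j hij a (ha : (j : ℝ) < ‖f a‖) => (Nat.cast_le.2 hij).trans_lt ha) ⟨0, measure_ne_top _ _⟩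
  have hempty : ⋂ n : ℕ, {a | (n : ℝ) < ‖f a‖} = ∅ := by
    refine Set.eq_empty_of_forall_notMem fun a ha => ?_
    obtain ⟨n, hn⟩ := exists_nat_ge ‖f a‖
    exact absurd (Set.mem_iInter.1 ha n) (not_lt.2 hn)
  rwa [hempty, measure_empty] at h

/-! ### Open-loop trajectories -/

section OpenLoop
variable {N m : ℕ} {U M : Type*}

/-- The trajectory of the semilinear system under a fixed sequence of control values. -/
noncomputable def openLoop (A : U → Matrix.GeneralLinearGroup (Fin N) ℝ)
    (B : Matrix (Fin N) (Fin m) ℝ) (c : ℕ → U × EuclideanSpace ℝ (Fin m))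
    (w : ℕ → EuclideanSpace ℝ (Fin N)) (x₀ : EuclideanSpace ℝ (Fin N)) :
    ℕ → EuclideanSpace ℝ (Fin N)
  | 0 => x₀
  | t + 1 => semilinear A B (openLoop A B c w x₀ t) (c t) (w t)

/-- A two-sided sequence extending the `U`-components of a one-sided control sequence; the value
at time zero is repeated at negative times. -/
def baseSequence {V : Type*} (c : ℕ → U × V) : ℤ → U := fun s => (c s.toNat).1

/-- The control values selected by the policy `γ` when the channel delivers the symbols `q`. -/
def controlSequence {X C : Type*} (γ : CausalPolicy X M C) (q : ℕ → M) (t : ℕ) : C :=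
  γ.control t fun i : Fin (t + 1) => q i

/-- Extension of a word by a constant letter. -/
def extendWord {T : ℕ} (a : M) (q : Fin T → M) (i : ℕ) : M := if h : i < T then q ⟨i, h⟩ else a

variable (A : U → Matrix.GeneralLinearGroup (Fin N) ℝ) (B : Matrix (Fin N) (Fin m) ℝ)

theorem openLoop_eq_Phi_add (c : ℕ → U × EuclideanSpace ℝ (Fin m))
    (w : ℕ → EuclideanSpace ℝ (Fin N)) (x₀ : EuclideanSpace ℝ (Fin N)) (t : ℕ) :
    openLoop A B c w x₀ t = Phi A t (baseSequence c) x₀ + openLoop A B c w 0 t := by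
  induction t with
  | zero => rw [Phi_zero]; simp [openLoop]
  | succ t ih =>
    rw [openLoop, semilinear, ih, map_add, Phi_succ, openLoop, semilinear]
    simp only [baseSequence, Int.toNat_natCast]
    abel

theorem continuous_openLoop (c : ℕ → U × EuclideanSpace ℝ (Fin m)) (t : ℕ) :
    Continuous fun p : EuclideanSpace ℝ (Fin N) × (ℕ → EuclideanSpace ℝ (Fin N)) =>
      openLoop A B c p.2 p.1 t := by
  induction t with
  | zero => exact continuous_fst
  | succ t ih =>
    have h := (LinearMap.continuous_of_finiteDimensional
      (Matrix.toEuclideanLin ((A (c t).1).val : Matrix (Fin N) (Fin N) ℝ))).comp ih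
    exact (h.add continuous_const).add ((continuous_apply t).comp continuous_snd)

theorem openLoop_congr {c c' : ℕ → U × EuclideanSpace ℝ (Fin m)}
    (w : ℕ → EuclideanSpace ℝ (Fin N)) (x₀ : EuclideanSpace ℝ (Fin N)) {t : ℕ}
    (h : ∀ s < t, c s = c' s) : openLoop A B c w x₀ t = openLoop A B c' w x₀ t := by
  induction t with
  | zero => rfl
  | succ t ih =>
    rw [openLoop, openLoop, ih fun s hs => h s (hs.trans t.lt_succ_self), h t t.lt_succ_self]

/-- Up to time `T` the closed loop follows one of the finitely many open-loop trajectories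
labelled by the words of length `T` over the channel alphabet. -/
theorem exists_closedLoop_eq_openLoop
    (γ : CausalPolicy (EuclideanSpace ℝ (Fin N)) M (U × EuclideanSpace ℝ (Fin m)))
    (w : ℕ → EuclideanSpace ℝ (Fin N)) (x₀ : EuclideanSpace ℝ (Fin N)) (a : M) (T : ℕ) :
    ∃ q : Fin T → M, closedLoop (semilinear A B) γ x₀ w T
      = openLoop A B (controlSequence γ (extendWord a q)) w x₀ T := by
  let σ : ℕ → M := fun i =>
    γ.encode i fun j : Fin (i + 1) => closedLoop (semilinear A B) γ x₀ w j
  have h (t : ℕ) : closedLoop (semilinear A B) γ x₀ w t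
      = openLoop A B (controlSequence γ σ) w x₀ t := by
    induction t with
    | zero => rw [closedLoop_zero, openLoop]
    | succ t ih => rw [closedLoop_succ, openLoop, ← ih]; rfl
  refine ⟨fun i => σ i, (h T).trans (openLoop_congr A B w x₀ fun s hs => ?_)⟩
  refine congrArg (γ.control s) (funext fun i => ?_)
  have hi : (i : ℕ) < T := by omega
  simp [extendWord, hi]

end OpenLoop

/-! ### Escape of mass -/

section Escape
variable {N m : ℕ} {U : Type*}
  {A : U → Matrix.GeneralLinearGroup (Fin N) ℝ} {B : Matrix (Fin N) (Fin m) ℝ}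
  {V₁ V₂ : (ℤ → U) → Submodule ℝ (EuclideanSpace ℝ (Fin N))}

/-- Uniform bound on the volume of the bounded initial states that a fixed control sequence and a
fixed noise realization bring back to a bounded state at time `T`. -/
theorem exists_volume_openLoop_le [TopologicalSpace U] [CompactSpace U]
    (hV : ∀ u, IsCompl (V₁ u) (V₂ u))
    (hV₁_cont : IsContinuousSubbundle V₁) (hV₂_cont : IsContinuousSubbundle V₂)
    (hV₁_inv : IsInvariant A V₁) (hV₂_inv : IsInvariant A V₂) (R : ℝ) :
    ∃ b : ENNReal, b ≠ ⊤ ∧ ∀ (c : ℕ → U × EuclideanSpace ℝ (Fin m))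
      (w : ℕ → EuclideanSpace ℝ (Fin N)) (T : ℕ),
      ENNReal.ofReal (absDet (fiberMap hV₁_inv T (baseSequence c))) *
        volume {y | ‖y‖ ≤ R ∧ ‖openLoop A B c w y T‖ ≤ R} ≤ b := by
  obtain ⟨κ, hκ0, hκ⟩ := exists_projection_bound hV hV₁_cont hV₂_cont
  refine ⟨_, (measure_closedBall_lt_top (μ := volume)
    (x := (0 : EuclideanSpace ℝ (Fin N))) (r := κ * R + R)).ne, fun c w T => ?_⟩
  have hset : {y | ‖y‖ ≤ R ∧ ‖openLoop A B c w y T‖ ≤ R}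
      = {y | ‖y‖ ≤ R ∧ ‖Phi A T (baseSequence c) y + openLoop A B c w 0 T‖ ≤ R} := by
    ext y
    rw [Set.mem_ofPred_eq, Set.mem_ofPred_eq, openLoop_eq_Phi_add A B c w y T]
  rw [hset]
  exact absDet_mul_volume_le (hV (baseSequence c)) (hV (shift T (baseSequence c)))
    (finrank_shift hV₁_inv T _) (Phi A T (baseSequence c)) (fiberMap hV₁_inv T _) (fun _ => rfl)
    (fun x hx => hV₂_inv T (baseSequence c) ▸ Submodule.mem_map_of_mem hx) hκ0 (hκ _) _ R

variable {Ω : Type*} [MeasurableSpace Ω] {P : Measure Ω} [IsProbabilityMeasure P]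
  {x₀ : Ω → EuclideanSpace ℝ (Fin N)} {w : ℕ → Ω → EuclideanSpace ℝ (Fin N)}
  {M : Type*} [Fintype M]
  {γ : CausalPolicy (EuclideanSpace ℝ (Fin N)) M (U × EuclideanSpace ℝ (Fin m))}
  {x : ℕ → Ω → EuclideanSpace ℝ (Fin N)}

/-- The event that a bounded initial state leads to a bounded state at time `T` is contained in
the event that one of the `#M ^ T` open-loop trajectories does so. The latter is measurable
whether or not the policy is, and independence of `x₀` and `w` bounds it section by section. -/
theorem measure_bounded_le (hx₀ : Measurable x₀) (hw : ∀ t, Measurable (w t))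
    (hx₀w : IndepFun x₀ (fun ω t => w t ω) P)
    (hx : ∀ t ω, x t ω = closedLoop (semilinear A B) γ (x₀ ω) (fun s => w s ω) t)
    (R : ℝ) (T : ℕ) {ε : ENNReal}
    (hε : ∀ (w : ℕ → EuclideanSpace ℝ (Fin N)) (a : M), P.map x₀ (⋃ q : Fin T → M,
      {y | ‖y‖ ≤ R ∧ ‖openLoop A B (controlSequence γ (extendWord a q)) w y T‖ ≤ R}) ≤ ε) :
    P {ω | ‖x₀ ω‖ ≤ R ∧ ‖x T ω‖ ≤ R} ≤ ε := by
  let a : M := γ.encode 0 fun _ => 0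
  let G : Set (EuclideanSpace ℝ (Fin N) × (ℕ → EuclideanSpace ℝ (Fin N))) := ⋃ q : Fin T → M,
    {p | ‖p.1‖ ≤ R ∧ ‖openLoop A B (controlSequence γ (extendWord a q)) p.2 p.1 T‖ ≤ R}
  have hG : MeasurableSet G := MeasurableSet.iUnion fun q =>
    ((isClosed_le continuous_fst.norm continuous_const).inter
      (isClosed_le (continuous_openLoop A B _ T).norm continuous_const)).measurableSet
  have hw' : Measurable fun ω t => w t ω := measurable_pi_lambda _ hw
  have := Measure.isProbabilityMeasure_map (μ := P) hx₀.aemeasurable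
  have := Measure.isProbabilityMeasure_map (μ := P) hw'.aemeasurable
  calc P {ω | ‖x₀ ω‖ ≤ R ∧ ‖x T ω‖ ≤ R}
      ≤ P ((fun ω => (x₀ ω, fun t => w t ω)) ⁻¹' G) := by
        refine measure_mono fun ω hω => ?_
        obtain ⟨q, hq⟩ := exists_closedLoop_eq_openLoop A B γ (fun t => w t ω) (x₀ ω) a T
        exact Set.mem_iUnion.2 ⟨q, hω.1, by rw [← hq, ← hx]; exact hω.2⟩
    _ = ((P.map x₀).prod (P.map fun ω t => w t ω)) G := by
        rw [← (indepFun_iff_map_prod_eq_prod_map_map hx₀.aemeasurable hw'.aemeasurable).1 hx₀w,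
          Measure.map_apply (hx₀.prodMk hw') hG]
    _ = ∫⁻ v, P.map x₀ ((fun y => (y, v)) ⁻¹' G) ∂(P.map fun ω t => w t ω) :=
        Measure.prod_apply_symm hG
    _ ≤ ∫⁻ _, ε ∂(P.map fun ω t => w t ω) := by
        refine lintegral_mono fun v => ?_
        rw [Set.preimage_iUnion]
        exact hε v a
    _ = ε := by simp

/-- When the growth rate `c` of `|det Φ|_{V₁}|` exceeds the channel capacity, the number of words
is too small to compensate the contraction of volume, and the event that both the initial state and
the state at time `T` are bounded becomes negligible. -/
theorem tendsto_measure_bounded_zero [TopologicalSpace U] [CompactSpace U]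
    (hx₀ : Measurable x₀) (hw : ∀ t, Measurable (w t))
    (hx₀w : IndepFun x₀ (fun ω t => w t ω) P) (hπ₀ : P.map x₀ ≪ volume)
    (hx : ∀ t ω, x t ω = closedLoop (semilinear A B) γ (x₀ ω) (fun s => w s ω) t)
    (hV : ∀ u, IsCompl (V₁ u) (V₂ u))
    (hV₁_cont : IsContinuousSubbundle V₁) (hV₂_cont : IsContinuousSubbundle V₂)
    (hV₁_inv : IsInvariant A V₁) (hV₂_inv : IsInvariant A V₂)
    {a c : ℝ} (ha : 0 < a) (hc : channelCapacity M < c)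
    (hgrowth : ∀ (t : ℕ) (u : ℤ → U),
      a * (2 : ℝ) ^ (c * t) ≤ absDet (fiberMap hV₁_inv t u)) (R : ℝ) :
    Tendsto (fun T => P {ω | ‖x₀ ω‖ ≤ R ∧ ‖x T ω‖ ≤ R}) atTop (𝓝 0) := by
  have := Measure.isProbabilityMeasure_map (μ := P) hx₀.aemeasurable
  have : Nonempty M := ⟨γ.encode 0 fun _ => 0⟩
  have hcard : (0 : ℝ) < Fintype.card M := Nat.cast_pos.2 Fintype.card_pos
  obtain ⟨b, hb, hvol⟩ := exists_volume_openLoop_le (B := B) hV hV₁_cont hV₂_cont hV₁_inv hV₂_inv R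
  -- The total volume of the `#M ^ T` sets is at most `b / a * (#M / 2 ^ c) ^ T`.
  let ρ : ℝ := Fintype.card M / 2 ^ c
  have hρ0 : 0 ≤ ρ := by positivity
  have hρ1 : ρ < 1 := by
    rw [div_lt_one (by positivity)]
    exact (Real.logb_lt_iff_lt_rpow one_lt_two hcard).1 hc
  have hunion (v : ℕ → EuclideanSpace ℝ (Fin N)) (k : M) (T : ℕ) :
      volume (⋃ q : Fin T → M,
        {y | ‖y‖ ≤ R ∧ ‖openLoop A B (controlSequence γ (extendWord k q)) v y T‖ ≤ R})
        ≤ ENNReal.ofReal (ρ ^ T) * (b / ENNReal.ofReal a) := by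
    have hd : 0 < a * (2 : ℝ) ^ (c * T) := by positivity
    calc _ ≤ ∑ _q : Fin T → M, b / ENNReal.ofReal (a * (2 : ℝ) ^ (c * T)) := by
          refine (measure_iUnion_fintype_le _ _).trans (Finset.sum_le_sum fun q _ => ?_)
          rw [ENNReal.le_div_iff_mul_le (by simp [hd]) (by simp), mul_comm]
          exact (mul_le_mul_left (ENNReal.ofReal_le_ofReal (hgrowth T _)) _).trans (hvol _ v T)
      _ = _ := by
          rw [Finset.sum_const, Finset.card_univ, Fintype.card_fun, Fintype.card_fin,
            nsmul_eq_mul, ENNReal.ofReal_mul ha.le, div_eq_mul_inv, div_eq_mul_inv,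
            ENNReal.mul_inv (by simp [ha]) (by simp), div_pow, ← Real.rpow_mul_natCast two_pos.le,
            ENNReal.ofReal_div_of_pos (by positivity), div_eq_mul_inv,
            ← Nat.cast_pow, ENNReal.ofReal_natCast]
          ring
  have hlim : Tendsto (fun T : ℕ => ENNReal.ofReal (ρ ^ T) * (b / ENNReal.ofReal a)) atTop
      (𝓝 0) := by
    have h := ENNReal.tendsto_ofReal (tendsto_pow_atTop_nhds_zero_of_lt_one hρ0 hρ1)
    have h' := ENNReal.Tendsto.mul_const (b := b / ENNReal.ofReal a) h
      (Or.inr (ENNReal.div_ne_top hb (by simp [ha])))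
    simpa using h'
  refine ENNReal.tendsto_nhds_zero.2 fun ε hε => ?_
  obtain ⟨δ, hδ, hsmall⟩ := exists_pos_forall_measure_lt hπ₀ hε.ne'
  filter_upwards [hlim.eventually (eventually_lt_nhds hδ)] with T hT
  exact measure_bounded_le hx₀ hw hx₀w hx R T fun v k =>
    (hsmall _ ((hunion v k T).trans_lt hT)).le

end Escape

/-! ### Asymptotic mean stationarity prevents escape of mass -/

theorem leftShift_iterate_apply {X : Type*} (t s : ℕ) (y : ℕ → X) :
    leftShift^[t] y s = y (s + t) := by
  induction t generalizing s with
  | zero => rfl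
  | succ t ih => rw [Function.iterate_succ_apply', leftShift, ih]; congr 1; omega

/-- A process whose one-dimensional laws lose all their mass to infinity is not asymptotically mean
stationary, because the limit law would give mass one to each of a sequence of sets decreasing to
the empty set. -/
theorem not_isAMS_of_tendsto_measure_bounded_zero {Ω E : Type*} [MeasurableSpace Ω]
    {P : Measure Ω} [IsProbabilityMeasure P] [NormedAddCommGroup E] [MeasurableSpace E]
    [BorelSpace E] {x : ℕ → Ω → E} (hx : ∀ t, Measurable (x t))
    (h : ∀ R : ℝ, Tendsto (fun T => P {ω | ‖x T ω‖ ≤ R}) atTop (𝓝 0)) : ¬ IsAMS P x := by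
  rintro ⟨Q, hQ, hlim⟩
  have hone (n : ℕ) : Q.real {y : ℕ → E | (n : ℝ) < ‖y 0‖} = 1 := by
    have hF : MeasurableSet {y : ℕ → E | (n : ℝ) < ‖y 0‖} :=
      measurableSet_lt measurable_const (measurable_pi_apply 0).norm
    have hlaw (t : ℕ) : (processLaw P x).real (leftShift^[t] ⁻¹' {y | (n : ℝ) < ‖y 0‖})
        = 1 - P.real {ω | ‖x t ω‖ ≤ n} := by
      have hpre : leftShift^[t] ⁻¹' {y : ℕ → E | (n : ℝ) < ‖y 0‖} = {y | (n : ℝ) < ‖y t‖} := by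
        ext y
        simp [leftShift_iterate_apply]
      rw [hpre, processLaw, map_measureReal_apply (measurable_pi_lambda _ hx)
        (measurableSet_lt measurable_const (measurable_pi_apply t).norm),
        ← probReal_compl_eq_one_sub (measurableSet_le (hx t).norm measurable_const)]
      congr 1
      ext ω
      simp
    have h1 : Tendsto (fun t => 1 - P.real {ω | ‖x t ω‖ ≤ n}) atTop (𝓝 (1 - 0)) :=
      tendsto_const_nhds.sub ((ENNReal.tendsto_toReal ENNReal.zero_ne_top).comp (h n))
    have h2 := hlim _ hF
    simp only [hlaw, one_div] at h2
    rw [tendsto_nhds_unique h2 h1.cesaro, sub_zero]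
  have h0 := (ENNReal.tendsto_toReal ENNReal.zero_ne_top).comp
    (tendsto_measure_natCast_lt_norm Q (measurable_pi_apply (X := fun _ : ℕ => E) 0))
  exact one_ne_zero (tendsto_nhds_unique (tendsto_const_nhds.congr fun n => (hone n).symm) h0)

end NetworkedControl

theorem mainTheorem2
    {N m : ℕ}
    {U : Type*} [MetricSpace U] [CompactSpace U]
    (A : U → Matrix.GeneralLinearGroup (Fin N) ℝ) (hA : Continuous A)
    (B : Matrix (Fin N) (Fin m) ℝ)
    {Ω : Type*} [MeasurableSpace Ω] (P : Measure Ω) [IsProbabilityMeasure P]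
    (x₀ : Ω → EuclideanSpace ℝ (Fin N)) (hx₀ : Measurable x₀)
    (w : ℕ → Ω → EuclideanSpace ℝ (Fin N)) (hw : ∀ t, Measurable (w t))
    (hw_indep : iIndepFun w P) (hw_ident : ∀ t, IdentDistrib (w t) (w 0) P P)
    (hx₀w : IndepFun x₀ (fun ω t => w t ω) P)
    (hπ₀ : P.map x₀ ≪ volume)
    (V₁ V₂ : (ℤ → U) → Submodule ℝ (EuclideanSpace ℝ (Fin N)))
    (hV : ∀ u, IsCompl (V₁ u) (V₂ u))
    (hV₁_cont : NetworkedControl.IsContinuousSubbundle V₁)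
    (hV₂_cont : NetworkedControl.IsContinuousSubbundle V₂)
    (hV₁_inv : NetworkedControl.IsInvariant A V₁)
    (hV₂_inv : NetworkedControl.IsInvariant A V₂)
    {M : Type*} [Fintype M]
    (γ : NetworkedControl.CausalPolicy (EuclideanSpace ℝ (Fin N)) M
      (U × EuclideanSpace ℝ (Fin m)))
    (x : ℕ → Ω → EuclideanSpace ℝ (Fin N))
    (hx : ∀ t ω, x t ω =
      NetworkedControl.closedLoop (NetworkedControl.semilinear A B) γ (x₀ ω) (fun s => w s ω) t)
    (hx_meas : ∀ t, Measurable (x t))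
    (hAMS : NetworkedControl.IsAMS P x) :
    (NetworkedControl.channelCapacity M : EReal) ≥
      ⨅ u : ℤ → U, limsup (fun t : ℕ =>
        ((1 / (t : ℝ) * Real.logb 2
          (NetworkedControl.absDet (NetworkedControl.fiberMap hV₁_inv (t : ℤ) u)) : ℝ) : EReal))
        atTop := by
  by_contra hlt
  obtain ⟨c, hCc, hc⟩ := EReal.lt_iff_exists_real_btwn.1 (not_le.1 hlt)
  have hgrow (u : ℤ → U) : ∃ t : ℕ, 0 < t ∧ c < 1 / (t : ℝ) *
      Real.logb 2 (NetworkedControl.absDet (NetworkedControl.fiberMap hV₁_inv (t : ℤ) u)) := by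
    have h := frequently_lt_of_lt_limsup (by isBoundedDefault) (hc.trans_le (iInf_le _ u))
    obtain ⟨t, ht, htpos⟩ := (h.and_eventually (eventually_gt_atTop 0)).exists
    exact ⟨t, htpos, EReal.coe_lt_coe_iff.1 ht⟩
  obtain ⟨a, ha, hgrowth⟩ :=
    NetworkedControl.exists_le_absDet_fiberMap hA hV₁_cont hV₁_inv hgrow
  have hjoint := NetworkedControl.tendsto_measure_bounded_zero hx₀ hw hx₀w hπ₀ hx hV hV₁_cont
    hV₂_cont hV₁_inv hV₂_inv ha (EReal.coe_lt_coe_iff.1 hCc) hgrowth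
  refine NetworkedControl.not_isAMS_of_tendsto_measure_bounded_zero hx_meas (fun R => ?_) hAMS
  refine ENNReal.tendsto_nhds_zero.2 fun ε hε => ?_
  have hε2 : 0 < ε / 2 := ENNReal.half_pos hε.ne'
  -- A radius `n ≥ R` outside of which `x₀` has mass less than `ε / 2`.
  obtain ⟨n, hn, hnR⟩ := (((NetworkedControl.tendsto_measure_natCast_lt_norm P hx₀).eventually
    (eventually_lt_nhds hε2)).and (eventually_ge_atTop ⌈R⌉₊)).exists
  filter_upwards [(hjoint n).eventually (eventually_lt_nhds hε2)] with T hT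
  calc P {ω | ‖x T ω‖ ≤ R}
      ≤ P ({ω | (n : ℝ) < ‖x₀ ω‖} ∪ {ω | ‖x₀ ω‖ ≤ n ∧ ‖x T ω‖ ≤ n}) := by
        refine measure_mono fun ω hω => ?_
        rcases lt_or_ge (n : ℝ) ‖x₀ ω‖ with h | h
        · exact Or.inl h
        · exact Or.inr ⟨h, le_trans hω ((Nat.le_ceil R).trans (Nat.cast_le.2 hnR))⟩
    _ ≤ ε / 2 + ε / 2 := (measure_union_le _ _).trans (add_le_add hn.le hT.le)
    _ = ε := ENNReal.add_halves ε
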